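/- **Theorem (homotopic faithfully flat descent).** Let $(\mathscr V,\otimes,\Bbbk)$ be a closed symmetric monoidal model category. Assume that for every algebra (monoid) $A$ in $\mathscr V$ the category $\mathscr V_A$ of right $A$-modules is equipped with a model structure whose weak equivalences are created by the forgetful functor $\mathscr V_A\to\mathscr V$, and that for every coring $(A,C)$ in $\mathscr V$ (an algebra $A$ and a comonoid $C$ in the monoidal category $({}_A\mathscr V_A,\otimes_A,A)$ of $A$-bimodules) the category $\mathscr V_A^C$ of right $(A,C)$-comodules is equipped with the model structure left-induced from $\mathscr V_A$: a morphism of $\mathscr V_A^C$ is a weak equivalence (resp. cofibration) if and only if the underlying morphism of $\mathscr V_A$ is one. Let $(A,C)$ be a flat coring, i.e. $-\otimes_A C\colon\mathscr V_A\to\mathscr V$ preserves coreflexive equalizers. Let $B$ be an algebra and let ${}_AX_B$ be a right dualizable bimodule: there are a bimodule ${}_BX^\vee_A$ and bimodule maps $u\colon A\to X\otimes_B X^\vee$, $e\colon X^\vee\otimes_A X\to B$ satisfying the triangle identities. Suppose that $-\otimes_A X\colon\mathscr V_A\to\mathscr V_B$ is a left Quillen functor, and that $X$ is homotopy faithfully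 flat as a left $A$-module, i.e. * $-\otimes_A X\colon\mathscr V_A\to\mathscr V$ preserves and reflects weak equivalences, and * for every finite category $\mathsf J$ and every functor $\Phi\colon\mathsf J\to\mathscr V_A$ the natural map $(\lim_{\mathsf J}\Phi)\otimes_A X\to\lim_{\mathsf J}(\Phi\otimes_A X)$ is a weak equivalence in $\mathscr V$. Let $X_*(C)=X^\vee\otimes_A C\otimes_A X$ be the canonical $B$-coring, with comultiplication $(1\otimes u\otimes 1)(1\otimes\Delta_C\otimes 1)$ (where $u$ is inserted between the two copies of $C$) and counit $e(1\otimes\epsilon_C\otimes 1)$, and let $\operatorname{Can}_X\colon\mathscr V_A^C\to\mathscr V_B^{X_*(C)}$ be the functor that sends $(M,\delta)$ to $M\otimes_A X$ with coaction $$M\otimes_A X\xrightarrow{\delta\otimes 1}M\otimes_A C\otimes_A X\xrightarrow{1\otimes u\otimes 1}M\otimes_A X\otimes_B X_*(C).$$ Then $X$ satisfies effective homotopic descent with respect to $(A,C)$: the functor $\operatorname{Can}_X$ has a right adjoint $\operatorname{Prim}_X$, and the adjunction $\operatorname{Can}_X\dashv\operatorname{Prim}_X$ is a Quillen equivalence.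 -/

import Mathlib

universe w v u

open CategoryTheory

namespace HomotopicDescent

/-!
Corings, comodules and braided bimodules.  Everything in this section is stated in a bicategory;
it is used below for the bicategory of algebras and bimodules in `V`, in which `X ≫ Y` is the
tensor product `X ⊗_B Y` of an `A`-`B`-bimodule and a `B`-`C`-bimodule, and `𝟙 A` is the
`A`-bimodule `A`.  An `A`-coring is then a comonoid `C : Comon (A ⟶ A)` in the monoidal category
of `A`-bimodules.
-/

section Bicat
open Bicategory

variable {B : Type u} [Bicategory.{w, v} B] {a b : B}

/-- The natural map `1 ⊗ ε : M ⊗_A C ⟶ M ⊗_A A ≅ M`. -/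
def comodCounit (e : B) (C : Comon (a ⟶ a)) : postcomp e C.X ⟶ 𝟭 (e ⟶ a) where
  app M := M ◁ Comonad.counit (t := C.X) ≫ (ρ_ M).hom
  naturality M N f := by
    simp [postcomp, ← whisker_exchange_assoc]

/-- The natural map `1 ⊗ Δ : M ⊗_A C ⟶ M ⊗_A (C ⊗_A C) ≅ (M ⊗_A C) ⊗_A C`. -/
def comodComul (e : B) (C : Comon (a ⟶ a)) :
    postcomp e C.X ⟶ postcomp e C.X ⋙ postcomp e C.X where
  app M := M ◁ Comonad.comul (t := C.X) ≫ (α_ M C.X C.X).inv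
  naturality M N f := by
    simp [postcomp, ← whisker_exchange_assoc]

/-- The comonad `- ⊗_A C` of a coring `C`.  Its coalgebras are the right `C`-comodules: objects `M`
with `δ : M ⟶ M ⊗_A C` such that `(1 ⊗ ε) δ = 1` and `(1 ⊗ Δ) δ = (δ ⊗ 1) δ`; the morphisms are
those commuting with `δ`. -/
def comodComonad (e : B) (C : Comon (a ⟶ a)) : CategoryTheory.Comonad (e ⟶ a) :=
  ⟨postcomp e C.X, comodCounit e C, comodComul e C,
  by
    intro M
    have h2 := congrArg (fun k => M ◁ k) (Comonad.comul_assoc_flip C.X)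
    simp only [Bicategory.whiskerLeft_comp] at h2
    simp [comodComul, postcomp, reassoc_of% h2],
  by
    intro M
    have h2 := congrArg (fun k => M ◁ k) (Comonad.comul_counit C.X)
    simp only [Bicategory.whiskerLeft_comp] at h2
    simp [comodComul, comodCounit, postcomp, reassoc_of% h2],
  by
    intro M
    have h2 := congrArg (fun k => M ◁ k) (Comonad.counit_comul C.X)
    simp only [Bicategory.whiskerLeft_comp] at h2
    simp [comodComul, comodCounit, postcomp, reassoc_of% h2]⟩

/-- A braiding `T : C ⊗_A X ⟶ X ⊗_B D`, satisfying the pentagon axiom and the counit axiom. -/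
structure Braiding (C : Comon (a ⟶ a)) (D : Comon (b ⟶ b)) (X : a ⟶ b) where
  /-- the underlying morphism of bimodules -/
  hom : C.X ≫ X ⟶ X ≫ D.X
  pentagon : Comonad.comul (t := C.X) ▷ X ≫ (α_ C.X C.X X).hom ≫ C.X ◁ hom ≫
      (α_ C.X X D.X).inv ≫ hom ▷ D.X ≫ (α_ X D.X D.X).hom =
    hom ≫ X ◁ Comonad.comul (t := D.X)
  counit_comp : hom ≫ X ◁ Comonad.counit (t := D.X) ≫ (ρ_ X).hom =
    Comonad.counit (t := C.X) ▷ X ≫ (λ_ X).hom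

variable (C : Comon (a ⟶ a)) {x : a ⟶ b} {y : b ⟶ a}

/-- For `x` with right dual `y`: the comultiplication
`Y ⊗ C ⊗ X ⟶ Y ⊗ C ⊗ C ⊗ X ⟶ (Y ⊗ C ⊗ X) ⊗_B (Y ⊗ C ⊗ X)` given by `1 ⊗ Δ ⊗ 1` followed by
the coevaluation inserted in the middle. -/
def canonicalComul (adj : Bicategory.Adjunction x y) : y ≫ C.X ≫ x ⟶ (y ≫ C.X ≫ x) ≫ (y ≫ C.X ≫ x) :=
  y ◁ Comonad.comul (t := C.X) ▷ x ⊗≫ (y ≫ C.X) ◁ adj.unit ▷ (C.X ≫ x) ⊗≫ 𝟙 _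
/-- The counit `Y ⊗_A C ⊗_A X ⟶ Y ⊗_A X ⟶ B`. -/
def canonicalCounit (adj : Bicategory.Adjunction x y) : y ≫ C.X ≫ x ⟶ 𝟙 b :=
  y ◁ Comonad.counit (t := C.X) ▷ x ⊗≫ adj.counit

theorem canonical_counit_comul (adj : Bicategory.Adjunction x y) :
    canonicalComul C adj ≫ canonicalCounit C adj ▷ (y ≫ C.X ≫ x) = (λ_ _).inv := by
  calc
    _ = y ◁ Comonad.comul (t := C.X) ▷ x ⊗≫
          y ◁ (C.X ◁ adj.unit ≫ Comonad.counit (t := C.X) ▷ (x ≫ y)) ▷ (C.X ≫ x) ⊗≫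
            adj.counit ▷ y ▷ (C.X ≫ x) ⊗≫ 𝟙 _ := by
      dsimp only [canonicalComul, canonicalCounit]; bicategory
    _ = y ◁ (Comonad.comul (t := C.X) ≫ Comonad.counit (t := C.X) ▷ C.X) ▷ x ⊗≫
          rightZigzag adj.unit adj.counit ▷ (C.X ≫ x) ⊗≫ 𝟙 _ := by
      rw [whisker_exchange]; dsimp only [rightZigzag]; bicategory
    _ = (λ_ _).inv := by
      rw [Comonad.counit_comul, adj.right_triangle]; bicategory

theorem canonical_comul_counit (adj : Bicategory.Adjunction x y) :
    canonicalComul C adj ≫ (y ≫ C.X ≫ x) ◁ canonicalCounit C adj = (ρ_ _).inv := by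
  calc
    _ = y ◁ Comonad.comul (t := C.X) ▷ x ⊗≫
          (y ≫ C.X) ◁ (adj.unit ▷ C.X ≫ (x ≫ y) ◁ Comonad.counit (t := C.X)) ▷ x ⊗≫
            (y ≫ C.X) ◁ x ◁ adj.counit ⊗≫ 𝟙 _ := by
      dsimp only [canonicalComul, canonicalCounit]; bicategory
    _ = y ◁ (Comonad.comul (t := C.X) ≫ C.X ◁ Comonad.counit (t := C.X)) ▷ x ⊗≫
          (y ≫ C.X) ◁ leftZigzag adj.unit adj.counit ⊗≫ 𝟙 _ := by
      rw [← whisker_exchange]; dsimp only [leftZigzag]; bicategory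
    _ = (ρ_ _).inv := by
      rw [Comonad.comul_counit, adj.left_triangle]; bicategory

theorem canonical_comul_assoc (adj : Bicategory.Adjunction x y) :
    canonicalComul C adj ≫ (y ≫ C.X ≫ x) ◁ canonicalComul C adj =
      canonicalComul C adj ≫ canonicalComul C adj ▷ (y ≫ C.X ≫ x) ≫ (α_ _ _ _).hom := by
  calc
    _ = y ◁ Comonad.comul (t := C.X) ▷ x ⊗≫
          (y ≫ C.X) ◁ (adj.unit ▷ C.X ≫ (x ≫ y) ◁ Comonad.comul (t := C.X)) ▷ x ⊗≫
            (y ≫ C.X ≫ x ≫ y ≫ C.X) ◁ adj.unit ▷ (C.X ≫ x) ⊗≫ 𝟙 _ := by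
      dsimp only [canonicalComul]; bicategory
    _ = y ◁ (Comonad.comul (t := C.X) ≫ C.X ◁ Comonad.comul (t := C.X)) ▷ x ⊗≫
          (y ≫ C.X) ◁ (adj.unit ▷ (C.X ≫ 𝟙 a) ≫ (x ≫ y) ◁ C.X ◁ adj.unit) ▷ (C.X ≫ x) ⊗≫ 𝟙 _ := by
      rw [← whisker_exchange]; bicategory
    _ = y ◁ Comonad.comul (t := C.X) ▷ x ⊗≫
          y ◁ (Comonad.comul (t := C.X) ▷ (𝟙 a) ≫ (C.X ≫ C.X) ◁ adj.unit) ▷ (C.X ≫ x) ⊗≫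
          (y ≫ C.X) ◁ adj.unit ▷ (C.X ≫ (x ≫ y) ≫ C.X ≫ x) ⊗≫ 𝟙 _ := by
      rw [Comonad.comul_assoc, ← whisker_exchange]; bicategory
    _ = _ := by
      rw [← whisker_exchange]
      dsimp only [canonicalComul]; bicategory

/-- The canonical coring `X_*(C) = Y ⊗_A C ⊗_A X`, where `Y` is the right dual of `X`. -/
def canonicalCoring (adj : Bicategory.Adjunction x y) : Comon (b ⟶ b) where
  X := y ≫ C.X ≫ x
  comon :=
    { counit := canonicalCounit C adj
      comul := canonicalComul C adj
      counit_comul := canonical_counit_comul C adj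
      comul_counit := canonical_comul_counit C adj
      comul_assoc := canonical_comul_assoc C adj }

/-- The universal braiding `u ⊗ 1 : C ⊗_A X ⟶ X ⊗_B X_*(C)`. -/
def universalBraiding (adj : Bicategory.Adjunction x y) : Braiding C (canonicalCoring C adj) x where
  hom := (λ_ _).inv ≫ adj.unit ▷ (C.X ≫ x) ≫ (α_ x y (C.X ≫ x)).hom
  pentagon := by
    change _ = _ ≫ x ◁ canonicalComul C adj
    change Comonad.comul (t := C.X) ▷ x ≫ (α_ C.X C.X x).hom ≫ C.X ◁ _ ≫
      (α_ C.X x (y ≫ C.X ≫ x)).inv ≫ _ ▷ (y ≫ C.X ≫ x) ≫ (α_ x (y ≫ C.X ≫ x) (y ≫ C.X ≫ x)).hom = _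
    symm
    calc
      _ = 𝟙 _ ⊗≫ (adj.unit ▷ C.X ≫ (x ≫ y) ◁ Comonad.comul (t := C.X)) ▷ x ⊗≫
          (x ≫ y ≫ C.X) ◁ adj.unit ▷ (C.X ≫ x) ⊗≫ 𝟙 _ := by
        dsimp only [canonicalComul]; bicategory
      _ = 𝟙 _ ⊗≫ Comonad.comul (t := C.X) ▷ x ⊗≫
          (adj.unit ▷ (C.X ≫ 𝟙 a) ≫ (x ≫ y) ◁ C.X ◁ adj.unit) ▷ (C.X ≫ x) ⊗≫ 𝟙 _ := by
        rw [← whisker_exchange]; bicategory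
      _ = _ := by
        rw [← whisker_exchange]; bicategory
  counit_comp := by
    change _ ≫ x ◁ canonicalCounit C adj ≫ _ = _
    calc
      _ = 𝟙 _ ⊗≫ (adj.unit ▷ C.X ≫ (x ≫ y) ◁ Comonad.counit (t := C.X)) ▷ x ⊗≫
          x ◁ adj.counit ⊗≫ 𝟙 _ := by
        dsimp only [canonicalCounit]; bicategory
      _ = Comonad.counit (t := C.X) ▷ x ⊗≫ leftZigzag adj.unit adj.counit ⊗≫ 𝟙 _ := by
        rw [← whisker_exchange]; dsimp only [leftZigzag]; bicategory
      _ = _ := by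
        rw [adj.left_triangle]; bicategory

variable {C} {D : Comon (b ⟶ b)}

/-- The structure map `M ⟶ M ⊗_A C` of a comodule. -/
def coaction {e : B} (M : (comodComonad e C).Coalgebra) : M.A ⟶ M.A ≫ C.X := M.a

/-- The coaction `M ⊗_A X ⟶ M ⊗_A C ⊗_A X ⟶ M ⊗_A X ⊗_B D` induced by a braiding. -/
def inducedCoaction (e : B) (T : Braiding C D x) (M : (comodComonad e C).Coalgebra) :
    M.A ≫ x ⟶ (M.A ≫ x) ≫ D.X :=
  coaction M ▷ x ≫ (α_ M.A C.X x).hom ≫ M.A ◁ T.hom ≫ (α_ M.A x D.X).inv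

/-- The functor `T_*` from `C`-comodules to `D`-comodules governed by a braiding `T` on `X`; its
underlying functor is `- ⊗_A X`. -/
def inducedFunctor (e : B) (T : Braiding C D x) :
    (comodComonad e C).Coalgebra ⥤ (comodComonad e D).Coalgebra where
  obj M :=
    { A := M.A ≫ x
      a := inducedCoaction e T M
      counit := by
        have h : coaction M ≫ M.A ◁ Comonad.counit (t := C.X) ≫ (ρ_ M.A).hom = 𝟙 _ := M.counit
        change inducedCoaction e T M ≫ (M.A ≫ x) ◁ Comonad.counit (t := D.X) ≫ (ρ_ (M.A ≫ x)).hom = 𝟙 _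
        calc
          _ = coaction M ▷ x ⊗≫
              M.A ◁ (T.hom ≫ x ◁ Comonad.counit (t := D.X) ≫ (ρ_ x).hom) ⊗≫ 𝟙 _ := by
            dsimp only [inducedCoaction]; bicategory
          _ = (coaction M ≫ M.A ◁ Comonad.counit (t := C.X) ≫ (ρ_ M.A).hom) ▷ x := by
            rw [T.counit_comp]; bicategory
          _ = _ := by rw [h]; bicategory
      coassoc := by
        have h : coaction M ≫ M.A ◁ Comonad.comul (t := C.X) ≫ (α_ M.A C.X C.X).inv =
          coaction M ≫ coaction M ▷ C.X := M.coassoc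
        change inducedCoaction e T M ≫ (M.A ≫ x) ◁ Comonad.comul (t := D.X) ≫ (α_ (M.A ≫ x) D.X D.X).inv =
          inducedCoaction e T M ≫ inducedCoaction e T M ▷ D.X
        calc
          _ = coaction M ▷ x ⊗≫
              M.A ◁ (T.hom ≫ x ◁ Comonad.comul (t := D.X)) ⊗≫ 𝟙 _ := by
            dsimp only [inducedCoaction]; bicategory
          _ = (coaction M ≫ M.A ◁ Comonad.comul (t := C.X) ≫
                (α_ M.A C.X C.X).inv) ▷ x ⊗≫ M.A ◁ C.X ◁ T.hom ⊗≫ M.A ◁ T.hom ▷ D.X ⊗≫ 𝟙 _ := by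
            rw [← T.pentagon]; bicategory
          _ = coaction M ▷ x ⊗≫
               (coaction M ▷ (C.X ≫ x) ≫ (M.A ≫ C.X) ◁ T.hom) ⊗≫
                M.A ◁ T.hom ▷ D.X ⊗≫ 𝟙 _ := by
            rw [h]; bicategory
          _ = _ := by
            rw [← whisker_exchange]; dsimp only [inducedCoaction]; bicategory }
  map {M N} f :=
    { f := f.f ▷ x
      h := by
        have h : coaction M ≫ f.f ▷ C.X = f.f ≫ coaction N := f.h
        change inducedCoaction e T M ≫ f.f ▷ x ▷ D.X = f.f ▷ x ≫ inducedCoaction e T N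
        calc
          _ = coaction M ▷ x ⊗≫ (M.A ◁ T.hom ≫ f.f ▷ (x ≫ D.X)) ⊗≫ 𝟙 _ := by
            dsimp only [inducedCoaction]; bicategory
          _ = (coaction M ≫ f.f ▷ C.X) ▷ x ⊗≫ N.A ◁ T.hom ⊗≫ 𝟙 _ := by
            rw [whisker_exchange]; bicategory
          _ = _ := by
            rw [h]; dsimp only [inducedCoaction]; bicategory }
  map_id M := by
    apply CategoryTheory.Comonad.Coalgebra.Hom.ext
    exact id_whiskerRight _ _
  map_comp f g := by
    apply CategoryTheory.Comonad.Coalgebra.Hom.ext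
    exact comp_whiskerRight _ _ _

/-- The functor `(T^univ)_*` from `C`-comodules to `X_*(C)`-comodules. -/
def canonicalFunctor (e : B) (C : Comon (a ⟶ a)) (adj : Bicategory.Adjunction x y) :
    (comodComonad e C).Coalgebra ⥤ (comodComonad e (canonicalCoring C adj)).Coalgebra :=
  inducedFunctor e (universalBraiding C adj)

end Bicat

/-! Model categories. -/

section Model

open Limits MonoidalCategory HomotopicalAlgebra

instance (V : Type u) [Category.{v} V] [ModelCategory V] : HasCoequalizers V :=
  hasColimitsOfShape_of_hasFiniteColimits V WalkingParallelPair

/-- The pushout-product `K ⊗ Y ⊔_{K ⊗ X} L ⊗ X ⟶ L ⊗ Y` of `j : K ⟶ L` and `i : X ⟶ Y`. -/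
noncomputable def pushoutProduct {V : Type u} [Category.{v} V] [MonoidalCategory V] [HasPushouts V]
    {K L X Y : V} (j : K ⟶ L) (i : X ⟶ Y) : pushout (K ◁ i) (j ▷ X) ⟶ L ⊗ Y :=
  pushout.desc (j ▷ Y) (L ◁ i) (whisker_exchange j i)

/-- The compatibility axiom of a (closed) symmetric monoidal model category: pushout-products of
cofibrations have the left lifting property against fibrations, as soon as at least one of the
three morphisms is a weak equivalence. -/
class IsMonoidalModelCategory (V : Type u) [Category.{v} V] [MonoidalCategory V]
    [SymmetricCategory V] [MonoidalClosed V] [ModelCategory V] : Prop where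
  hasLiftingProperty {K L X Y E F : V} (j : K ⟶ L) (i : X ⟶ Y) (p : E ⟶ F)
    [Cofibration j] [Cofibration i] [Fibration p] :
    WeakEquivalence j ∨ WeakEquivalence i ∨ WeakEquivalence p →
      HasLiftingProperty (pushoutProduct j i) p

/-- A left adjoint functor between model categories is left Quillen if it preserves cofibrations
and trivial cofibrations. -/
structure IsLeftQuillen {M : Type*} [Category* M] {N : Type*} [Category* N]
    [ModelCategory M] [ModelCategory N] (F : M ⥤ N) : Prop where
  isLeftAdjoint : F.IsLeftAdjoint
  cofibration {X Y : M} (f : X ⟶ Y) : Cofibration f → Cofibration (F.map f)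
  trivialCofibration {X Y : M} (f : X ⟶ Y) : Cofibration f → WeakEquivalence f →
    Cofibration (F.map f) ∧ WeakEquivalence (F.map f)

/-- An adjunction `F ⊣ G` between model categories is a Quillen equivalence if `F` is left Quillen
and, for `X` cofibrant and `Y` fibrant, a morphism `F X ⟶ Y` is a weak equivalence if and only if
its adjunct `X ⟶ G Y` is one. -/
structure IsQuillenEquivalence {M : Type*} [Category* M] {N : Type*} [Category* N]
    [ModelCategory M] [ModelCategory N] {F : M ⥤ N} {G : N ⥤ M}
    (adj : CategoryTheory.Adjunction F G) : Prop where
  isLeftQuillen : IsLeftQuillen F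
  weakEquivalence_iff {X : M} {Y : N} [IsCofibrant X] [IsFibrant Y] (f : F.obj X ⟶ Y) :
    WeakEquivalence f ↔ WeakEquivalence (adj.homEquiv X Y f)

end Model

/-! Algebras, modules and comodules in a closed symmetric monoidal category. -/

section Alg

open Limits MonoidalCategory HomotopicalAlgebra

/-- Forget the right action: an `A`-`B`-bimodule viewed as an `A`-`𝟙`-bimodule. -/
def forgetRight {V : Type u} [Category.{v} V] [MonoidalCategory V] (A B : Mon V)
    (X : Bimod A B) : Bimod A (Mon.trivial V) where
  X := X.X
  actLeft := X.actLeft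
  one_actLeft := X.one_actLeft
  left_assoc := X.left_assoc
  actRight := (ρ_ X.X).hom
  actRight_one := by
    change X.X ◁ 𝟙 (𝟙_ V) ≫ (ρ_ X.X).hom = (ρ_ X.X).hom
    simp
  right_assoc := by
    change X.X ◁ (λ_ (𝟙_ V)).hom ≫ (ρ_ X.X).hom =
      (α_ X.X (𝟙_ V) (𝟙_ V)).inv ≫ (ρ_ X.X).hom ▷ 𝟙_ V ≫ (ρ_ X.X).hom
    monoidal
  middle_assoc := by
    change X.actLeft ▷ 𝟙_ V ≫ (ρ_ X.X).hom =
      (α_ A.X X.X (𝟙_ V)).hom ≫ A.X ◁ (ρ_ X.X).hom ≫ X.actLeft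
    simp

variable (V : Type u) [Category.{v} V] [MonoidalCategory V] [SymmetricCategory V]
  [MonoidalClosed V] [HasCoequalizers V]

/-- Algebras (monoids) in `V`; as a bicategory, its 1-morphisms `A ⟶ B` are the `A`-`B`-bimodules,
composed by the relative tensor product, and its 2-morphisms are the morphisms of bimodules. -/
def Alg := Mon V

noncomputable instance : Bicategory (Alg V) := Bimod.monBicategory (C := V)

/-- The unit of `V`, as an algebra. -/
def unitAlg : Alg V := Mon.trivial V

variable {V}

/-- The category `V_A` of right `A`-modules, as `𝟙`-`A`-bimodules; the left action of the unit
carries no information, see `unit_actLeft`. -/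
abbrev RightMod (A : Alg V) := unitAlg V ⟶ A

/-- Left `A`-modules, as `A`-`𝟙`-bimodules. -/
abbrev LeftMod (A : Alg V) := A ⟶ unitAlg V

theorem unit_actLeft {A : Alg V} (M : RightMod A) :
    Bimod.actLeft (A := Mon.trivial V) (B := (A : Mon V)) M =
      (λ_ (Bimod.X (A := Mon.trivial V) (B := (A : Mon V)) M)).hom := by
  have h := Bimod.one_actLeft (A := Mon.trivial V) (B := (A : Mon V)) M
  rw [← h]
  exact ((congrArg (· ≫ _) (id_whiskerRight _ _)).trans (Category.id_comp _)).symm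

/-- The functor sending a bimodule to its underlying object of `V`. -/
def underlying (A B : Alg V) : (A ⟶ B) ⥤ V := Bimod.forget (A : Mon V) (B := (B : Mon V))

/-- The left `A`-module underlying an `A`-`B`-bimodule. -/
def leftModule {A B : Alg V} (X : A ⟶ B) : LeftMod A :=
  forgetRight (A : Mon V) (B : Mon V) X

/-- The functor `- ⊗_A X : V_A ⥤ V_B` for an `A`-`B`-bimodule `X`. -/
noncomputable def tensorBimodule {A B : Alg V} (X : A ⟶ B) : RightMod A ⥤ RightMod B :=
  Bicategory.postcomp (unitAlg V) X

/-- The functor `- ⊗_A N : V_A ⥤ V` for a left `A`-module `N`. -/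
noncomputable def tensorLeftModule {A : Alg V} (N : LeftMod A) : RightMod A ⥤ V :=
  Bicategory.postcomp (unitAlg V) N ⋙ underlying (unitAlg V) (unitAlg V)

/-- A left `A`-module `N` is flat if `- ⊗_A N : V_A ⥤ V` preserves coreflexive equalizers. -/
def IsFlat {A : Alg V} (N : LeftMod A) : Prop :=
  ∀ ⦃M M' : RightMod A⦄ (f g : M ⟶ M'), IsCoreflexivePair f g →
    PreservesLimit (parallelPair f g) (tensorLeftModule N)

/-- An `A`-coring: a comonoid in the monoidal category of `A`-bimodules. -/
abbrev Coring (A : Alg V) := Comon (A ⟶ A)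

/-- A coring `(A, C)` is flat if `C` is flat as a left `A`-module. -/
def Coring.IsFlat {A : Alg V} (C : Coring A) : Prop := HomotopicDescent.IsFlat (leftModule C.X)

/-- The category `V_A^C` of right `(A, C)`-comodules. -/
abbrev Comod {A : Alg V} (C : Coring A) := (comodComonad (unitAlg V) C).Coalgebra

/-- The forgetful functor from `V_A^C` to `V_A`. -/
noncomputable abbrev forgetComod {A : Alg V} (C : Coring A) : Comod C ⥤ RightMod A :=
  (comodComonad (unitAlg V) C).forget

/-- The functor `Can_X` from `V_A^C` to `V_B^{X_*(C)}`, for an `A`-`B`-bimodule `X` with right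
dual `Y`. -/
noncomputable abbrev can {A B : Alg V} (C : Coring A) {X : A ⟶ B} {Y : B ⟶ A}
    (dual : Bicategory.Adjunction X Y) : Comod C ⥤ Comod (canonicalCoring C dual) :=
  canonicalFunctor (unitAlg V) C dual

end Alg

/-! Homotopical notions. -/

section Homotopy

open Limits MonoidalCategory HomotopicalAlgebra

variable {V : Type u} [Category.{v} V] [MonoidalCategory V] [SymmetricCategory V]
  [MonoidalClosed V] [ModelCategory V]

variable {A : Alg V} [ModelCategory (RightMod A)]

/-- `- ⊗_A N : V_A ⥤ V` preserves weak equivalences. -/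
def IsHomotopyFlat (N : LeftMod A) : Prop :=
  ∀ ⦃M M' : RightMod A⦄ (f : M ⟶ M'), WeakEquivalence f →
    WeakEquivalence ((tensorLeftModule N).map f)

/-- `N` is homotopy flat and the natural map `(lim Φ) ⊗_A N ⟶ lim (Φ ⊗_A N)` is a weak equivalence
for every finite diagram `Φ` of right `A`-modules. -/
def IsStronglyHomotopyFlat (N : LeftMod A) : Prop :=
  IsHomotopyFlat N ∧
    ∀ (J : Type) [SmallCategory J] [FinCategory J] (Φ : J ⥤ RightMod A),
      WeakEquivalence (limit.post Φ (tensorLeftModule N))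

/-- `- ⊗_A N : V_A ⥤ V` reflects weak equivalences. -/
def IsHomotopyFaithful (N : LeftMod A) : Prop :=
  ∀ ⦃M M' : RightMod A⦄ (f : M ⟶ M'), WeakEquivalence ((tensorLeftModule N).map f) →
    WeakEquivalence f

/-- `N` is homotopy faithful and strongly homotopy flat. -/
def IsHomotopyFaithfullyFlat (N : LeftMod A) : Prop :=
  IsHomotopyFaithful N ∧ IsStronglyHomotopyFlat N

/-- The bimodule `X`, with right dual `Y`, satisfies effective homotopic descent with respect to
`(A, C)`: the functor `Can_X` has a right adjoint `Prim_X`, and the adjunction is a Quillen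
equivalence. -/
def EffectiveHomotopicDescent {A B : Alg V} (C : Coring A) {X : A ⟶ B} {Y : B ⟶ A}
    (dual : Bicategory.Adjunction X Y) [ModelCategory (Comod C)]
    [ModelCategory (Comod (canonicalCoring C dual))] : Prop :=
  ∃ (prim : Comod (canonicalCoring C dual) ⥤ Comod C)
    (adj : CategoryTheory.Adjunction (can C dual) prim), IsQuillenEquivalence adj

end Homotopy

end HomotopicDescent

open HomotopicalAlgebra HomotopicDescent

/-!
`Can_X` preserves cofibrations, and it preserves and reflects weak equivalences, because its
underlying functor is `- ⊗_A X`. Hence `Can_X ⊣ Prim_X` is a Quillen equivalence as soon as every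
counit `Can_X (Prim_X N) ⟶ N` is a weak equivalence.

At a cofree comodule the counit is an isomorphism: `Prim_X (N ⊗_B X_*(C))` is the cofree comodule
`(N ⊗_B X^∨) ⊗_A C`, and the comparison map is the associator
`((N ⊗_B X^∨) ⊗_A C) ⊗_A X ≅ N ⊗_B X_*(C)`. An arbitrary comodule is a coreflexive equalizer of
cofree comodules that splits after forgetting the coaction. The functor `Prim_X` preserves this
equalizer as a right adjoint, the forgetful functor from `C`-comodules preserves it because `C` is
flat, and `- ⊗_A X` preserves it up to a weak equivalence; so the counit is a weak equivalence in
general.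
-/

namespace HomotopicDescent

open Limits

universe v₁ v₂ v₃ u₁ u₂ u₃

section Categories

variable {𝒜 : Type u₁} [Category.{v₁} 𝒜] {ℬ : Type u₂} [Category.{v₂} ℬ]
  {𝒱 : Type u₃} [Category.{v₃} 𝒱]

theorem prop_app_of_isLimit {J : Type*} [Category* J] {𝒟 : Type*} [Category* 𝒟]
    (W : MorphismProperty 𝒱) [W.RespectsIso] {P : 𝒟 ⥤ 𝒜} {T : 𝒜 ⥤ 𝒱} {S : 𝒟 ⥤ 𝒱}
    (τ : P ⋙ T ⟶ S) {Φ : J ⥤ 𝒟} [HasLimit (Φ ⋙ P)] [HasLimit ((Φ ⋙ P) ⋙ T)]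
    [PreservesLimit Φ P] [PreservesLimit Φ S] [∀ j, IsIso (τ.app (Φ.obj j))]
    (hW : W (limit.post (Φ ⋙ P) T)) {c : Cone Φ} (hc : IsLimit c) :
    W (τ.app c.pt) := by
  let source : T.obj (P.obj c.pt) ≅ T.obj (limit (Φ ⋙ P)) :=
    T.mapIso ((isLimitOfPreserves P hc).conePointUniqueUpToIso (limit.isLimit _))
  let diagram : (Φ ⋙ P) ⋙ T ≅ Φ ⋙ S :=
    NatIso.ofComponents (fun j => asIso (τ.app (Φ.obj j))) fun f => τ.naturality (Φ.map f)
  let target : limit ((Φ ⋙ P) ⋙ T) ≅ S.obj c.pt :=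
    (limit.isLimit _).conePointsIsoOfNatIso (isLimitOfPreserves S hc) diagram
  have factorization : source.hom ≫ limit.post (Φ ⋙ P) T ≫ target.hom = τ.app c.pt := by
    refine (isLimitOfPreserves S hc).hom_ext fun j => ?_
    have source_π : source.hom ≫ T.map (limit.π (Φ ⋙ P) j) = T.map (P.map (c.π.app j)) := by
      rw [Functor.mapIso_hom, ← T.map_comp]
      exact congrArg T.map ((isLimitOfPreserves P hc).conePointUniqueUpToIso_hom_comp _ j)
    have target_π : target.hom ≫ S.map (c.π.app j) =
        limit.π ((Φ ⋙ P) ⋙ T) j ≫ τ.app (Φ.obj j) :=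
      IsLimit.conePointsIsoOfNatIso_hom_comp _ _ _ j
    have naturality : T.map (P.map (c.π.app j)) ≫ τ.app (Φ.obj j) =
        τ.app c.pt ≫ S.map (c.π.app j) := τ.naturality (c.π.app j)
    simp only [Functor.mapCone_π_app, Category.assoc, target_π, limit.post_π_assoc,
      reassoc_of% source_π, naturality]
  rw [← factorization]
  exact (W.cancel_left_of_respectsIso _ _).2 ((W.cancel_right_of_respectsIso _ _).2 hW)

theorem isIso_counit_app_iff {K : 𝒜 ⥤ ℬ} {P : ℬ ⥤ 𝒜} (adj : K ⊣ P) {H : ℬ ⥤ 𝒱} {S : 𝒱 ⥤ ℬ}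
    (adj' : H ⊣ S) {L : 𝒱 ⥤ 𝒜} (adj'' : K ⋙ H ⊣ L) (Q : 𝒱) :
    IsIso (adj.counit.app (S.obj Q)) ↔
      IsIso (adj'.homEquiv (K.obj (L.obj Q)) Q (adj''.counit.app Q)) := by
  let θ : L.obj Q ≅ P.obj (S.obj Q) := (adj''.rightAdjointUniq (adj.comp adj')).app Q
  have factorization : K.map θ.hom ≫ adj.counit.app (S.obj Q) =
      adj'.homEquiv (K.obj (L.obj Q)) Q (adj''.counit.app Q) := by
    rw [← Equiv.symm_apply_eq, adj'.homEquiv_counit, H.map_comp, Category.assoc]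
    simpa [θ] using Adjunction.rightAdjointUniq_hom_app_counit adj'' (adj.comp adj') Q
  rw [← factorization, isIso_comp_left_iff]

instance isCoreflexivePair_map (F : 𝒜 ⥤ ℬ) {M N : 𝒜} (f g : M ⟶ N) [IsCoreflexivePair f g] :
    IsCoreflexivePair (F.map f) (F.map g) := by
  obtain ⟨r, hf, hg⟩ := IsCoreflexivePair.common_retraction f g
  exact .mk' (F.map r) (by rw [← F.map_comp, hf, F.map_id]) (by rw [← F.map_comp, hg, F.map_id])

end Categories

section Comonads

open Comonad WalkingParallelPairHom

variable {𝒜 : Type u₁} [Category.{v₁} 𝒜] {ℬ : Type u₂} [Category.{v₂} ℬ]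
  {𝒱 : Type u₃} [Category.{v₃} 𝒱]

theorem preservesLimit_of_isCoreflexivePair {𝒟 : Type*} [Category.{v₁} 𝒟] (F : 𝒜 ⥤ 𝒟)
    [PreservesLimitOfIsCoreflexivePair F] (Φ : WalkingParallelPair ⥤ 𝒜)
    [IsCoreflexivePair (Φ.map left) (Φ.map right)] :
    PreservesLimit Φ F :=
  preservesLimit_of_iso_diagram F (diagramIsoParallelPair Φ).symm

instance preservesLimitOfIsCoreflexivePair_forget (G : Comonad 𝒜) [HasEqualizers 𝒜]
    [PreservesLimitOfIsCoreflexivePair G.toFunctor] :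
    PreservesLimitOfIsCoreflexivePair G.forget where
  out M N f g _ := by
    have : IsCoreflexivePair
        ((parallelPair f g ⋙ G.forget).map left)
        ((parallelPair f g ⋙ G.forget).map right) :=
      isCoreflexivePair_map G.forget f g
    have : PreservesLimit (parallelPair f g ⋙ G.forget) G.toFunctor :=
      preservesLimit_of_isCoreflexivePair _ _
    have : PreservesLimit ((parallelPair f g ⋙ G.forget) ⋙ G.toFunctor) G.toFunctor := by
      have : IsCoreflexivePair
          (((parallelPair f g ⋙ G.forget) ⋙ G.toFunctor).map left)
          (((parallelPair f g ⋙ G.forget) ⋙ G.toFunctor).map right) :=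
        isCoreflexivePair_map G.toFunctor (G.forget.map f) (G.forget.map g)
      exact preservesLimit_of_isCoreflexivePair _ _
    infer_instance

instance preservesLimit_cofreePair (D : Comonad ℬ) (N : D.Coalgebra) (U : ℬ ⥤ 𝒱) :
    PreservesLimit (parallelPair (CofreeEqualizer.topMap N) (CofreeEqualizer.bottomMap N))
      (D.forget ⋙ U) :=
  preservesLimit_of_preserves_limit_cone (beckCoalgebraEqualizer N)
    ((isLimitMapConeForkEquiv (D.forget ⋙ U) (CofreeEqualizer.condition N)).symm
      ((beckSplitEqualizer N).map U).isEqualizer)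

theorem prop_map_counit_of_isIso_cofree {G : Comonad 𝒜} {D : Comonad ℬ}
    [HasEqualizers 𝒜] [HasEqualizers 𝒱] [PreservesLimitOfIsCoreflexivePair G.toFunctor]
    (W : MorphismProperty 𝒱) [W.RespectsIso] {T : 𝒜 ⥤ 𝒱} {U : ℬ ⥤ 𝒱}
    (hT : ∀ Φ : WalkingParallelPair ⥤ 𝒜, W (limit.post Φ T))
    {K : G.Coalgebra ⥤ D.Coalgebra} (lift : G.forget ⋙ T ≅ K ⋙ D.forget ⋙ U)
    {P : D.Coalgebra ⥤ G.Coalgebra} (adj : K ⊣ P)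
    (hcofree : ∀ Q, IsIso (adj.counit.app (D.cofree.obj Q))) (N : D.Coalgebra) :
    W (U.map (adj.counit.app N).f) := by
  let τ : (P ⋙ G.forget) ⋙ T ⟶ D.forget ⋙ U :=
    Functor.whiskerLeft P lift.hom ≫ Functor.whiskerRight adj.counit (D.forget ⋙ U)
  let Φ := parallelPair (CofreeEqualizer.topMap N) (CofreeEqualizer.bottomMap N)
  have : ∀ j, IsIso (τ.app (Φ.obj j)) := by
    have h (Q : ℬ) : IsIso (τ.app (D.cofree.obj Q)) := by
      have := hcofree Q
      exact inferInstanceAs (IsIso (_ ≫ (D.forget ⋙ U).map _))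
    rintro (_ | _) <;> exact h _
  have : PreservesLimit Φ P :=
    adj.rightAdjoint_preservesLimits.preservesLimitsOfShape.preservesLimit
  have : PreservesLimit (Φ ⋙ P) G.forget := by
    have : IsCoreflexivePair ((Φ ⋙ P).map left)
        ((Φ ⋙ P).map right) :=
      isCoreflexivePair_map P (CofreeEqualizer.topMap N) (CofreeEqualizer.bottomMap N)
    exact preservesLimit_of_isCoreflexivePair _ _
  exact (W.cancel_left_of_respectsIso (lift.hom.app (P.obj N)) _).1
    (prop_app_of_isLimit W τ (hT (Φ ⋙ P ⋙ G.forget)) (beckCoalgebraEqualizer N))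

theorem comonadAdj_homEquiv_apply_f (G : Comonad 𝒜) (M : G.Coalgebra) {Q : 𝒜}
    (f : G.forget.obj M ⟶ Q) : (G.adj.homEquiv M Q f).f = M.a ≫ G.map f := by
  rw [Adjunction.homEquiv_unit, Comonad.adj_unit]
  rfl

end Comonads

section Bicategories

open Bicategory

variable {B : Type u} [Bicategory.{w, v} B] {a b : B} (e : B) {x : a ⟶ b} {y : b ⟶ a}

/-- The adjunction `- ⊗ x ⊣ - ⊗ y` for a 1-morphism `x` with right dual `y`. -/
def postcompAdjunction (adj : Bicategory.Adjunction x y) : postcomp e x ⊣ postcomp e y where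
  unit :=
    { app M := (ρ_ M).inv ≫ M ◁ adj.unit ≫ (α_ M x y).inv
      naturality M N f := by
        calc f ≫ (ρ_ N).inv ≫ N ◁ adj.unit ≫ (α_ N x y).inv
          _ = 𝟙 _ ⊗≫ (f ▷ 𝟙 a ≫ N ◁ adj.unit) ⊗≫ 𝟙 _ := by bicategory
          _ = ((ρ_ M).inv ≫ M ◁ adj.unit ≫ (α_ M x y).inv) ≫ f ▷ x ▷ y := by
            rw [← whisker_exchange]; bicategory }
  counit :=
    { app N := (α_ N y x).hom ≫ N ◁ adj.counit ≫ (ρ_ N).hom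
      naturality M N f := by
        calc f ▷ y ▷ x ≫ (α_ N y x).hom ≫ N ◁ adj.counit ≫ (ρ_ N).hom
          _ = 𝟙 _ ⊗≫ (f ▷ (y ≫ x) ≫ N ◁ adj.counit) ⊗≫ 𝟙 _ := by bicategory
          _ = ((α_ M y x).hom ≫ M ◁ adj.counit ≫ (ρ_ M).hom) ≫ f := by
            rw [← whisker_exchange]; bicategory }
  left_triangle_components M := by
    calc ((ρ_ M).inv ≫ M ◁ adj.unit ≫ (α_ M x y).inv) ▷ x ≫
          (α_ (M ≫ x) y x).hom ≫ (M ≫ x) ◁ adj.counit ≫ (ρ_ (M ≫ x)).hom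
      _ = 𝟙 _ ⊗≫ M ◁ leftZigzag adj.unit adj.counit ⊗≫ 𝟙 _ := by
        dsimp only [leftZigzag]; bicategory
      _ = 𝟙 (M ≫ x) := by rw [adj.left_triangle]; bicategory
  right_triangle_components N := by
    calc ((ρ_ (N ≫ y)).inv ≫ (N ≫ y) ◁ adj.unit ≫ (α_ (N ≫ y) x y).inv) ≫
          ((α_ N y x).hom ≫ N ◁ adj.counit ≫ (ρ_ N).hom) ▷ y
      _ = 𝟙 _ ⊗≫ N ◁ rightZigzag adj.unit adj.counit ⊗≫ 𝟙 _ := by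
        dsimp only [rightZigzag]; bicategory
      _ = 𝟙 (N ≫ y) := by rw [adj.right_triangle]; bicategory

variable (C : Comon (a ⟶ a)) (adj : Bicategory.Adjunction x y)

/-- The adjunction exhibiting `N ↦ (N ⊗ y) ⊗ C` as right adjoint to `M ↦ M ⊗ x` on
`C`-comodules. -/
def canonicalFunctorCompForgetAdjunction :
    canonicalFunctor e C adj ⋙ (comodComonad e (canonicalCoring C adj)).forget ⊣
      postcomp e y ⋙ (comodComonad e C).cofree :=
  (comodComonad e C).adj.comp (postcompAdjunction e adj)

theorem canonicalFunctorCompForgetAdjunction_counit_app (N : e ⟶ b) :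
    (canonicalFunctorCompForgetAdjunction e C adj).counit.app N =
      ((N ≫ y) ◁ Comonad.counit (t := C.X) ≫ (ρ_ (N ≫ y)).hom) ▷ x ≫
        (α_ N y x).hom ≫ N ◁ adj.counit ≫ (ρ_ N).hom := by
  simp only [canonicalFunctorCompForgetAdjunction, Adjunction.comp_counit_app, Comonad.adj_counit]
  rfl

theorem homEquiv_counit_canonicalFunctorCompForgetAdjunction (N : e ⟶ b) :
    ((comodComonad e (canonicalCoring C adj)).adj.homEquiv _ N
      ((canonicalFunctorCompForgetAdjunction e C adj).counit.app N)).f =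
      (α_ (N ≫ y) C.X x).hom ≫ (α_ N y (C.X ≫ x)).hom := by
  refine (comonadAdj_homEquiv_apply_f _ _ _).trans ?_
  rw [canonicalFunctorCompForgetAdjunction_counit_app]
  change (((N ≫ y) ◁ Comonad.comul (t := C.X) ≫ (α_ _ _ _).inv) ▷ x ≫
      (α_ ((N ≫ y) ≫ C.X) C.X x).hom ≫
      ((N ≫ y) ≫ C.X) ◁ ((λ_ _).inv ≫ adj.unit ▷ (C.X ≫ x) ≫ (α_ x y (C.X ≫ x)).hom) ≫
      (α_ ((N ≫ y) ≫ C.X) x (y ≫ C.X ≫ x)).inv) ≫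
    (((N ≫ y) ◁ Comonad.counit (t := C.X) ≫ (ρ_ (N ≫ y)).hom) ▷ x ≫
      (α_ N y x).hom ≫ N ◁ adj.counit ≫ (ρ_ N).hom) ▷ (y ≫ C.X ≫ x) = _
  calc
    _ = 𝟙 _ ⊗≫ N ◁ (canonicalComul C adj ≫ canonicalCounit C adj ▷ (y ≫ C.X ≫ x)) ⊗≫ 𝟙 _ := by
      dsimp only [canonicalComul, canonicalCounit]; bicategory
    _ = _ := by
      rw [canonical_counit_comul]; bicategory

theorem isIso_counit_app_cofree
    {prim : (comodComonad e (canonicalCoring C adj)).Coalgebra ⥤ (comodComonad e C).Coalgebra}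
    (adj' : canonicalFunctor e C adj ⊣ prim) (N : e ⟶ b) :
    IsIso (adj'.counit.app ((comodComonad e (canonicalCoring C adj)).cofree.obj N)) := by
  rw [isIso_counit_app_iff adj' (comodComonad e (canonicalCoring C adj)).adj
    (canonicalFunctorCompForgetAdjunction e C adj)]
  have : IsIso ((comodComonad e (canonicalCoring C adj)).forget.map
      ((comodComonad e (canonicalCoring C adj)).adj.homEquiv _ N
        ((canonicalFunctorCompForgetAdjunction e C adj).counit.app N))) := by
    rw [Comonad.forget_map, homEquiv_counit_canonicalFunctorCompForgetAdjunction]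
    exact inferInstanceAs (IsIso ((α_ (N ≫ y) C.X x).hom ≫ (α_ N y (C.X ≫ x)).hom))
  exact isIso_of_reflects_iso _ (comodComonad e (canonicalCoring C adj)).forget

end Bicategories

section Modules

open MonoidalCategory

theorem reflectsLimit_bimodForget {V : Type u} [Category.{v} V] [MonoidalCategory V]
    (A B : Mon V) {J : Type*} [Category* J] (F : J ⥤ Bimod A B) :
    ReflectsLimit F (Bimod.forget A (B := B)) where
  reflects {c} hc := by
    obtain ⟨hc⟩ : Nonempty (IsLimit ((Bimod.forget A (B := B)).mapCone c)) := ⟨hc⟩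
    let lift (s : Cone F) : s.pt.X ⟶ c.pt.X := hc.lift ((Bimod.forget A (B := B)).mapCone s)
    have fac (s : Cone F) (j : J) : lift s ≫ (c.π.app j).hom = (s.π.app j).hom :=
      hc.fac ((Bimod.forget A (B := B)).mapCone s) j
    have left_act_lift (s : Cone F) : s.pt.actLeft ≫ lift s = A.X ◁ lift s ≫ c.pt.actLeft := by
      refine hc.hom_ext fun j => ?_
      change (_ ≫ lift s) ≫ (c.π.app j).hom = (_ ≫ _) ≫ (c.π.app j).hom
      simp only [Category.assoc, fac, Bimod.Hom.left_act_hom, ← whiskerLeft_comp_assoc]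
    have right_act_lift (s : Cone F) : s.pt.actRight ≫ lift s = lift s ▷ B.X ≫ c.pt.actRight := by
      refine hc.hom_ext fun j => ?_
      change (_ ≫ lift s) ≫ (c.π.app j).hom = (_ ≫ _) ≫ (c.π.app j).hom
      simp only [Category.assoc, fac, Bimod.Hom.right_act_hom, ← comp_whiskerRight_assoc]
    have : (Bimod.forget A (B := B)).Faithful := ⟨fun h => Bimod.hom_ext _ _ h⟩
    exact ⟨IsLimit.ofFaithful (Bimod.forget A) hc
      (fun s => ⟨lift s, left_act_lift s, right_act_lift s⟩) fun _ => rfl⟩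

variable {V : Type u} [Category.{v} V] [MonoidalCategory V] [SymmetricCategory V]
  [MonoidalClosed V] [HasCoequalizers V] {A B : Alg V} {X : A ⟶ B}

theorem IsFlat.preservesLimitOfIsCoreflexivePair_tensorBimodule (hX : IsFlat (leftModule X)) :
    Comonad.PreservesLimitOfIsCoreflexivePair (tensorBimodule X) where
  out M N f g hfg := by
    have : PreservesLimit (parallelPair f g) (tensorBimodule X ⋙ underlying (unitAlg V) B) :=
      hX f g hfg
    have : ReflectsLimit (parallelPair f g ⋙ tensorBimodule X) (underlying (unitAlg V) B) :=
      reflectsLimit_bimodForget _ _ _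
    exact preservesLimit_of_reflects_of_preserves _ (underlying (unitAlg V) B)

instance isLeftAdjoint_can {C : Coring A} {Y : B ⟶ A} (dual : Bicategory.Adjunction X Y)
    [HasCoreflexiveEqualizers (Comod C)] : (can C dual).IsLeftAdjoint :=
  have : (can C dual ⋙ forgetComod (canonicalCoring C dual)).IsLeftAdjoint :=
    (canonicalFunctorCompForgetAdjunction (unitAlg V) C dual).isLeftAdjoint
  isLeftAdjoint_triangle_lift_comonadic (forgetComod (canonicalCoring C dual))

end Modules

section Model

theorem isQuillenEquivalence_of_weakEquivalence_counit {M : Type*} [Category* M] {N : Type*}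
    [Category* N] [ModelCategory M] [ModelCategory N] {F : M ⥤ N} {G : N ⥤ M} (adj : F ⊣ G)
    (cofibration_map : ∀ ⦃X Y : M⦄ (f : X ⟶ Y), Cofibration f → Cofibration (F.map f))
    (weakEquivalence_map_iff : ∀ ⦃X Y : M⦄ (f : X ⟶ Y),
      WeakEquivalence (F.map f) ↔ WeakEquivalence f)
    (weakEquivalence_counit : ∀ (Y : N) [IsFibrant Y], WeakEquivalence (adj.counit.app Y)) :
    IsQuillenEquivalence adj where
  isLeftQuillen :=
    { isLeftAdjoint := adj.isLeftAdjoint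
      cofibration := fun f => cofibration_map f
      trivialCofibration := fun f hc hw =>
        ⟨cofibration_map f hc, (weakEquivalence_map_iff f).2 hw⟩ }
  weakEquivalence_iff {X Y} _ _ f := by
    have := weakEquivalence_counit Y
    have f_eq : F.map (adj.homEquiv X Y f) ≫ adj.counit.app Y = f :=
      (adj.homEquiv_counit X Y _).symm.trans (Equiv.symm_apply_apply _ f)
    rw [← weakEquivalence_map_iff, ← weakEquivalence_postcomp_iff _ (adj.counit.app Y), f_eq]

variable {V : Type u} [Category.{v} V] [MonoidalCategory V] [SymmetricCategory V]
  [MonoidalClosed V] [ModelCategory V] {A B : Alg V} {C : Coring A} {X : A ⟶ B} {Y : B ⟶ A}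
  (dual : Bicategory.Adjunction X Y)

theorem weakEquivalence_underlying_counit [HasEqualizers (RightMod A)] (hC : C.IsFlat)
    (hX : ∀ Φ : WalkingParallelPair ⥤ RightMod A,
      WeakEquivalence (limit.post Φ (tensorLeftModule (leftModule X))))
    {prim : Comod (canonicalCoring C dual) ⥤ Comod C}
    (adj : can C dual ⊣ prim) (N : Comod (canonicalCoring C dual)) :
    WeakEquivalence ((underlying (unitAlg V) B).map (adj.counit.app N).f) := by
  have : Comonad.PreservesLimitOfIsCoreflexivePair (comodComonad (unitAlg V) C).toFunctor :=
    hC.preservesLimitOfIsCoreflexivePair_tensorBimodule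
  rw [weakEquivalence_iff]
  exact prop_map_counit_of_isIso_cofree (weakEquivalences V)
    (T := tensorLeftModule (leftModule X)) (fun Φ => (weakEquivalence_iff _).1 (hX Φ))
    (Iso.refl _) adj (isIso_counit_app_cofree _ _ _ adj) N

end Model

end HomotopicDescent

open Limits in
theorem mainTheorem2_general
    {V : Type u} [Category.{v} V] [MonoidalCategory V] [SymmetricCategory V]
    [MonoidalClosed V] [ModelCategory V] {A B : Alg V} (C : Coring A) {X : A ⟶ B} {Y : B ⟶ A}
    (dual : Bicategory.Adjunction X Y)
    [ModelCategory (RightMod A)] [ModelCategory (RightMod B)] [ModelCategory (Comod C)]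
    [ModelCategory (Comod (canonicalCoring C dual))]
    (weakEquivalence_mod : ∀ {M N : RightMod B} (f : M ⟶ N),
      WeakEquivalence f ↔ WeakEquivalence ((underlying (unitAlg V) B).map f))
    (weakEquivalence_comod : ∀ {M N : Comod C} (f : M ⟶ N),
      WeakEquivalence f ↔ WeakEquivalence ((forgetComod C).map f))
    (cofibration_comod : ∀ {M N : Comod C} (f : M ⟶ N),
      Cofibration f → Cofibration ((forgetComod C).map f))
    (weakEquivalence_comod_canonical : ∀ {M N : Comod (canonicalCoring C dual)} (f : M ⟶ N),
      WeakEquivalence f ↔ WeakEquivalence ((forgetComod (canonicalCoring C dual)).map f))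
    (cofibration_comod_canonical : ∀ {M N : Comod (canonicalCoring C dual)} (f : M ⟶ N),
      Cofibration ((forgetComod (canonicalCoring C dual)).map f) → Cofibration f)
    (hC : C.IsFlat)
    (cofibration_tensor : ∀ {M N : RightMod A} (f : M ⟶ N),
      Cofibration f → Cofibration ((tensorBimodule X).map f))
    (faithful : IsHomotopyFaithful (leftModule X)) (flat : IsHomotopyFlat (leftModule X))
    (equalizers : ∀ Φ : WalkingParallelPair ⥤ RightMod A,
      WeakEquivalence (limit.post Φ (tensorLeftModule (leftModule X)))) :
    EffectiveHomotopicDescent C dual := by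
  have weakEquivalence_iff_underlying {M N : Comod (canonicalCoring C dual)} (f : M ⟶ N) :
      WeakEquivalence f ↔ WeakEquivalence ((underlying (unitAlg V) B).map f.f) :=
    (weakEquivalence_comod_canonical f).trans (weakEquivalence_mod f.f)
  let adj := Adjunction.ofIsLeftAdjoint (can C dual)
  refine ⟨_, adj, isQuillenEquivalence_of_weakEquivalence_counit adj
    (fun M N f hf => cofibration_comod_canonical _ (cofibration_tensor _ (cofibration_comod f hf)))
    (fun M N f => ?_) (fun N _ => ?_)⟩
  · rw [weakEquivalence_iff_underlying, weakEquivalence_comod]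
    exact ⟨@faithful _ _ f.f, @flat _ _ f.f⟩
  · rw [weakEquivalence_iff_underlying]
    exact weakEquivalence_underlying_counit dual hC equalizers adj N

theorem mainTheorem2
    -- a closed symmetric monoidal model category
    {V : Type u} [Category.{v} V] [MonoidalCategory V] [SymmetricCategory V]
    [MonoidalClosed V] [ModelCategory V] [IsMonoidalModelCategory V]
    -- model structures on all categories of right modules, with underlying weak equivalences
    [∀ A : Alg V, ModelCategory (RightMod A)]
    (weakEquivalence_mod : ∀ (A : Alg V) {M N : RightMod A} (f : M ⟶ N),
      WeakEquivalence f ↔ WeakEquivalence ((underlying (unitAlg V) A).map f))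
    -- left-induced model structures on all categories of comodules
    [∀ (A : Alg V) (C : Coring A), ModelCategory (Comod C)]
    (weakEquivalence_comod : ∀ (A : Alg V) (C : Coring A) {M N : Comod C} (f : M ⟶ N),
      WeakEquivalence f ↔ WeakEquivalence ((forgetComod C).map f))
    (cofibration_comod : ∀ (A : Alg V) (C : Coring A) {M N : Comod C} (f : M ⟶ N),
      Cofibration f ↔ Cofibration ((forgetComod C).map f))
    -- a flat coring `(A, C)` and a bimodule `X` with right dual `Y`
    (A B : Alg V) (C : Coring A) (hC : C.IsFlat)
    (X : A ⟶ B) (Y : B ⟶ A) (dual : Bicategory.Adjunction X Y)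
    (hQuillen : IsLeftQuillen (tensorBimodule X))
    (hX : IsHomotopyFaithfullyFlat (leftModule X)) :
    EffectiveHomotopicDescent C dual :=
  mainTheorem2_general C dual (weakEquivalence_mod B) (weakEquivalence_comod A C)
    (fun f => (cofibration_comod A C f).1) (weakEquivalence_comod B _)
    (fun f => (cofibration_comod B _ f).2) hC (hQuillen.cofibration ·) hX.1 hX.2.1 (hX.2.2 _)
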